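/- Let $(X_n)_{n\ge1}$ and $(\varepsilon_n)_{n\ge 2}$ be real random variables on a probability space such that, for all $n\ge1$, $$X_{2n}=\alpha_0X_n+\beta_0+\varepsilon_{2n},\qquad X_{2n+1}=\alpha_1X_n+\beta_1+\varepsilon_{2n+1},$$ where $\alpha_0,\alpha_1\in(-1,1)$ and $\beta_0,\beta_1\in\mathbb R$; the pairs $(\varepsilon_{2n},\varepsilon_{2n+1})$, $n\ge1$, are independent and identically distributed with the centered Gaussian law $\mathcal N_2(0,\Gamma)$, $\Gamma=\sigma^2\begin{pmatrix}1&\rho\\ \rho&1\end{pmatrix}$, with $\sigma>0$ and $\rho\in(-1,1)$; and $X_1$ has law $\nu$ and is independent of $((\varepsilon_{2n},\varepsilon_{2n+1}))_{n\ge1}$. (This is the bifurcating autoregressive, or BAR, model.) For $r\in\mathbb N$ let $\mathbb T_r=\bigcup_{q=0}^r\{2^q,2^q+1,\dots,2^{q+1}-1\}$ be the first $r+1$ generations of the binary tree, write $\overline{f}^{\,r}=|\mathbb T_r|^{-1}\sum_{i\in\mathbb T_r}f_i$ for the average of a family $(f_i)$ over $\mathbb T_r$, and define, for $e\in\{0,1\}$,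 the least squares estimators $$\hat\alpha_e^r=\frac{\overline{X_iX_{2i+e}}^{\,r}-\overline{X_i}^{\,r}\;\overline{X_{2i+e}}^{\,r}}{\overline{X_i^2}^{\,r}-\big(\overline{X_i}^{\,r}\big)^2},\qquad \hat\beta_e^r=\overline{X_{2i+e}}^{\,r}-\hat\alpha_e^r\,\overline{X_i}^{\,r},$$ the residues $\hat\varepsilon_{2i+e}=X_{2i+e}-\hat\alpha_e^rX_i-\hat\beta_e^r$ for $i\in\mathbb T_r$, and $$\hat\sigma_r^2=\frac1{2|\mathbb T_r|}\sum_{i\in\mathbb T_r}\big(\hat\varepsilon_{2i}^2+\hat\varepsilon_{2i+1}^2\big),\qquad \hat\rho_r=\frac1{\hat\sigma_r^2|\mathbb T_r|}\sum_{i\in\mathbb T_r}\hat\varepsilon_{2i}\hat\varepsilon_{2i+1}.$$ Assume that $\nu$ has finite moments of all orders. Then $((\hat\sigma_r^2,\hat\rho_r),\,r\in\mathbb N)$ is a strongly consistent estimator of $(\sigma^2,\rho)$: almost surely, the denominators above are nonzero for all large $r$ and $(\hat\sigma_r^2,\hat\rho_r)\to(\sigma^2,\rho)$ as $r\to\infty$.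 -/

import Mathlib

open MeasureTheory ProbabilityTheory Filter Topology

namespace BAR

noncomputable section

/-- The `q`-th generation `{2^q, …, 2^(q+1) - 1}` of the binary tree, whose vertices are the
positive integers, the daughters of `n` being `2n` and `2n + 1`. -/
def generation (q : ℕ) : Finset ℕ := Finset.Ico (2 ^ q) (2 ^ (q + 1))

/-- The subtree consisting of the generations `0, …, r`. -/
def subtree (r : ℕ) : Finset ℕ := (Finset.range (r + 1)).biUnion generation

/-- The average of `f` over the subtree of the first `r + 1` generations. -/
def treeMean (r : ℕ) (f : ℕ → ℝ) : ℝ := (∑ i ∈ subtree r, f i) / ((subtree r).card : ℝ)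

/-! The estimators below are functions of the data `x : ℕ → ℝ`. At rank `r` they only use the
values `x i` observed on the subtree of the first `r + 2` generations. An index `e : Fin 2`
distinguishes the two kinds of daughters: `e = 0` is the new pole, `e = 1` the old pole. -/

/-- Empirical variance of the mothers, the denominator of the slope estimators. -/
def motherVar (x : ℕ → ℝ) (r : ℕ) : ℝ :=
  treeMean r (fun i => x i ^ 2) - treeMean r x ^ 2

/-- Least squares estimator of the slope. -/
def alphaHat (x : ℕ → ℝ) (r : ℕ) (e : Fin 2) : ℝ :=
  (treeMean r (fun i => x i * x (2 * i + e)) - treeMean r x * treeMean r (fun i => x (2 * i + e)))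
    / motherVar x r

/-- Least squares estimator of the intercept. -/
def betaHat (x : ℕ → ℝ) (r : ℕ) (e : Fin 2) : ℝ :=
  treeMean r (fun i => x (2 * i + e)) - alphaHat x r e * treeMean r x

/-- The residue of the daughter `2 * i + e`. -/
def residue (x : ℕ → ℝ) (r : ℕ) (i : ℕ) (e : Fin 2) : ℝ :=
  x (2 * i + e) - alphaHat x r e * x i - betaHat x r e

/-- The residual-based estimator of the noise variance. -/
def sigmaSqHat (x : ℕ → ℝ) (r : ℕ) : ℝ :=
  (∑ i ∈ subtree r, (residue x r i 0 ^ 2 + residue x r i 1 ^ 2)) / (2 * ((subtree r).card : ℝ))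

/-- The residual-based estimator of the sister-sister correlation. -/
def rhoHat (x : ℕ → ℝ) (r : ℕ) : ℝ :=
  (∑ i ∈ subtree r, residue x r i 0 * residue x r i 1) /
    (sigmaSqHat x r * ((subtree r).card : ℝ))

/-- The covariance matrix of the noise of two sisters. -/
def noiseCov (σ ρ : ℝ) : Matrix (Fin 2) (Fin 2) ℝ := σ ^ 2 • !![1, ρ; ρ, 1]

/-- The noise vector `(ε (2n), ε (2n+1))`. -/
def noisePair {Ω : Type*} (ε : ℕ → Ω → ℝ) (n : ℕ+) (ω : Ω) : EuclideanSpace ℝ (Fin 2) :=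
  WithLp.toLp 2 fun e : Fin 2 => ε (2 * (n : ℕ) + e) ω

/-- `X` is a bifurcating autoregressive process with slopes `α e`, intercepts `β e`, noise `ε`
with variance `σ ^ 2` and sister-sister correlation `ρ`, and ancestor law `ν`. Only the indices
`n ≥ 1` of `X` and `n ≥ 2` of `ε` are meaningful; nothing is required of the others. -/
structure IsBAR {Ω : Type*} [MeasurableSpace Ω] (P : Measure Ω) (ν : Measure ℝ)
    (α β : Fin 2 → ℝ) (σ ρ : ℝ) (X ε : ℕ → Ω → ℝ) : Prop where
  measurable_process : ∀ n, 1 ≤ n → Measurable (X n)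
  measurable_noise : ∀ n, 2 ≤ n → Measurable (ε n)
  ancestor_law : HasLaw (X 1) ν P
  recursion : ∀ n, 1 ≤ n → ∀ (e : Fin 2) (ω : Ω),
    X (2 * n + e) ω = α e * X n ω + β e + ε (2 * n + e) ω
  noise_law : ∀ n : ℕ+, HasLaw (noisePair ε n) (multivariateGaussian 0 (noiseCov σ ρ)) P
  noise_indep : iIndepFun (fun n : ℕ+ => noisePair ε n) P
  ancestor_indep : IndepFun (X 1) (fun ω (n : ℕ+) => noisePair ε n ω) P

end

end BAR

namespace BAR

/-! ### Averages over the binary tree -/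

/-! The proof has a pathwise half and a probabilistic half, which meet in `IsRegularData`.

Pathwise: suppose the tree averages of the noise, of its products over sisters, and of mother times
daughter noise tend to 0, Γ and 0. A subtree is the root plus the daughters of the previous subtree
(`treeMean_succ`), so the averages of `x` and `x ^ 2` obey affine recursions in `r` whose slopes
tend to (α₀ + α₁)/2 and (α₀² + α₁²)/2, both of modulus below 1. Hence they converge, and the
limiting variance of the mothers is positive. The least squares estimators then converge, residues
differ from the noise by vanishing multiples of `x i` and 1, and their empirical covariances inherit
the limit Γ (`tendsto_treeMean_residue`).

Probabilistic: the two noise averages follow from the strong law. The products of mothers with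
daughter noise are orthogonal and bounded in L², so their average over a subtree has second moment
O(2⁻ʳ); this is summable, which forces almost sure convergence to 0
(`ae_tendsto_treeMean_mother_noise`). -/

lemma subtree_eq_Ico (r : ℕ) : subtree r = Finset.Ico 1 (2 ^ (r + 1)) := by
  induction r with
  | zero => simp [subtree, generation]
  | succ r ih =>
    have h : subtree (r + 1) = generation (r + 1) ∪ subtree r := by
      rw [subtree, Finset.range_add_one, Finset.biUnion_insert]
      rfl
    rw [h, ih, Finset.union_comm, generation, Finset.Ico_union_Ico_eq_Ico Nat.one_le_two_pow]
    exact Nat.pow_le_pow_right (by norm_num) (by omega)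

lemma card_subtree (r : ℕ) : (subtree r).card = 2 ^ (r + 1) - 1 := by
  simp [subtree_eq_Ico]

lemma card_subtree_cast (r : ℕ) : ((subtree r).card : ℝ) = 2 ^ (r + 1) - 1 := by
  rw [card_subtree, Nat.cast_sub Nat.one_le_two_pow]
  simp

lemma card_subtree_pos (r : ℕ) : (0 : ℝ) < (subtree r).card := by
  rw [card_subtree_cast, pow_succ]
  have : (1 : ℝ) ≤ 2 ^ r := one_le_pow₀ (by norm_num)
  linarith

lemma one_le_of_mem_subtree {r i : ℕ} (h : i ∈ subtree r) : 1 ≤ i := by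
  rw [subtree_eq_Ico, Finset.mem_Ico] at h
  exact h.1

lemma treeMean_congr {r : ℕ} {f g : ℕ → ℝ} (h : ∀ i, 1 ≤ i → f i = g i) :
    treeMean r f = treeMean r g := by
  rw [treeMean, treeMean, Finset.sum_congr rfl fun i hi => h i (one_le_of_mem_subtree hi)]

lemma treeMean_add (r : ℕ) (f g : ℕ → ℝ) :
    treeMean r (fun i => f i + g i) = treeMean r f + treeMean r g := by
  simp [treeMean, Finset.sum_add_distrib, add_div]

lemma treeMean_const_mul (r : ℕ) (c : ℝ) (f : ℕ → ℝ) :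
    treeMean r (fun i => c * f i) = c * treeMean r f := by
  simp [treeMean, ← Finset.mul_sum, mul_div_assoc]

lemma treeMean_const (r : ℕ) (c : ℝ) : treeMean r (fun _ => c) = c := by
  simp [treeMean, mul_div_cancel_left₀ _ (card_subtree_pos r).ne']

lemma sum_Ico_two_mul {M : Type*} [AddCommMonoid M] (f : ℕ → M) {n : ℕ} (hn : 1 ≤ n) :
    ∑ i ∈ Finset.Ico 1 (2 * n), f i
      = f 1 + ∑ i ∈ Finset.Ico 1 n, (f (2 * i) + f (2 * i + 1)) := by
  induction n, hn using Nat.le_induction with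
  | base => simp
  | succ n hn ih =>
    rw [show 2 * (n + 1) = 2 * n + 1 + 1 by ring, Finset.sum_Ico_succ_top (by omega),
      Finset.sum_Ico_succ_top (by omega), Finset.sum_Ico_succ_top hn, ih]
    simp only [add_assoc]

/-- The ratio of the sizes of two successive subtrees. -/
noncomputable def growthRatio (r : ℕ) : ℝ := (subtree r).card / (subtree (r + 1)).card

/-- Every vertex except the root has exactly one mother. This turns the branching recursion into a
scalar recursion in `r`. -/
lemma treeMean_succ (r : ℕ) (f : ℕ → ℝ) :
    treeMean (r + 1) f = f 1 / (subtree (r + 1)).card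
      + growthRatio r * (treeMean r (fun i => f (2 * i)) + treeMean r (fun i => f (2 * i + 1))) := by
  have h : ∑ i ∈ subtree (r + 1), f i
      = f 1 + ∑ i ∈ subtree r, (f (2 * i) + f (2 * i + 1)) := by
    rw [subtree_eq_Ico, subtree_eq_Ico, pow_succ', sum_Ico_two_mul f Nat.one_le_two_pow]
  have h0 := (card_subtree_pos r).ne'
  have h1 := (card_subtree_pos (r + 1)).ne'
  rw [treeMean, h, growthRatio, treeMean, treeMean, Finset.sum_add_distrib]
  field_simp

lemma tendsto_card_subtree : Tendsto (fun r => ((subtree r).card : ℝ)) atTop atTop := by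
  simp_rw [card_subtree_cast]
  refine tendsto_atTop_add_const_right _ _ ?_
  exact (tendsto_add_atTop_iff_nat 1).2 (tendsto_pow_atTop_atTop_of_one_lt (by norm_num))

lemma tendsto_growthRatio : Tendsto growthRatio atTop (𝓝 (1 / 2)) := by
  have h : ∀ r, growthRatio r = 1 / 2 - (1 / 2) / (subtree (r + 1)).card := by
    intro r
    have h1 := (card_subtree_pos (r + 1)).ne'
    rw [growthRatio]
    field_simp
    rw [card_subtree_cast, card_subtree_cast]
    ring
  rw [funext h]
  simpa using (tendsto_const_nhds (x := (1 / 2 : ℝ))).sub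
    (((tendsto_add_atTop_iff_nat 1).2 tendsto_card_subtree).const_div_atTop (1 / 2))

/-! ### Contracting recursions -/

lemma tendsto_zero_of_contracting {u c : ℕ → ℝ} {q : ℝ} (hu : ∀ n, 0 ≤ u n) (hq0 : 0 ≤ q)
    (hq1 : q < 1) (hc : Tendsto c atTop (𝓝 0))
    (h : ∀ᶠ n in atTop, u (n + 1) ≤ q * u n + c n) : Tendsto u atTop (𝓝 0) := by
  rw [tendsto_order]
  refine ⟨fun a ha => Eventually.of_forall fun n => ha.trans_le (hu n), fun δ hδ => ?_⟩
  -- δ/2 is the fixed point of v ↦ q v + (1 - q) δ/2, so the excess of `u` over δ/2 shrinks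
  -- geometrically.
  have hc' : ∀ᶠ n in atTop, c n < (1 - q) * (δ / 2) :=
    hc.eventually_lt_const (mul_pos (by linarith) (by linarith))
  obtain ⟨N, hN⟩ := eventually_atTop.1 (h.and hc')
  have key : ∀ k, u (N + k) - δ / 2 ≤ q ^ k * u N := by
    intro k
    induction k with
    | zero => simp; linarith
    | succ k ih =>
      obtain ⟨h1, h2⟩ := hN (N + k) (by omega)
      have := mul_le_mul_of_nonneg_left ih hq0
      rw [← add_assoc, pow_succ]
      nlinarith
  have hp : Tendsto (fun k => q ^ k * u N) atTop (𝓝 0) := by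
    simpa using (tendsto_pow_atTop_nhds_zero_of_lt_one hq0 hq1).mul_const (u N)
  obtain ⟨K, hK⟩ := eventually_atTop.1 (hp.eventually_lt_const (half_pos hδ))
  filter_upwards [eventually_ge_atTop (N + K)] with n hn
  have h1 := key (n - N)
  have h2 := hK (n - N) (by omega)
  rw [show N + (n - N) = n by omega] at h1
  linarith

/-- The distance to the fixed point of the limiting map contracts eventually by any factor in (|A|,
1), up to the vanishing error |a n * L + b n - L|. -/
lemma exists_tendsto_of_affine_recursion {m a b : ℕ → ℝ} {A B : ℝ} (hA : |A| < 1)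
    (ha : Tendsto a atTop (𝓝 A)) (hb : Tendsto b atTop (𝓝 B))
    (h : ∀ n, m (n + 1) = a n * m n + b n) : ∃ L, Tendsto m atTop (𝓝 L) ∧ L = A * L + B := by
  obtain ⟨L, hL⟩ : ∃ L, L = A * L + B := by
    have hA1 : 1 - A ≠ 0 := by
      have := (abs_lt.1 hA).2
      linarith
    refine ⟨B / (1 - A), ?_⟩
    field_simp
    ring
  refine ⟨L, ?_, hL⟩
  have hLB : A * L + B - L = 0 := by linarith
  obtain ⟨q, hq, hq1⟩ := exists_between hA
  have hd : Tendsto (fun n => |m n - L|) atTop (𝓝 0) := by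
    refine tendsto_zero_of_contracting (c := fun n => |a n * L + b n - L|) (fun n => abs_nonneg _)
      ((abs_nonneg A).trans hq.le) hq1 ?_ ?_
    · have : Tendsto (fun n => |a n * L + b n - L|) atTop (𝓝 |A * L + B - L|) :=
        (((ha.mul_const L).add hb).sub_const L).abs
      rwa [hLB, abs_zero] at this
    · filter_upwards [ha.abs.eventually_lt_const hq] with n hn
      have : m (n + 1) - L = a n * (m n - L) + (a n * L + b n - L) := by
        rw [h]
        ring
      rw [this]
      refine (abs_add_le _ _).trans (add_le_add_left ?_ _)
      rw [abs_mul]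
      exact mul_le_mul_of_nonneg_right hn.le (abs_nonneg _)
  have := (tendsto_zero_iff_abs_tendsto_zero _).2 hd
  simpa using this.add_const L

/-! ### Consistency for a deterministic data set -/

/-- `x` follows the bifurcating recursion with noise `η`, and the empirical moments of `η` and its
products with `x` converge to the moments predicted by the model. -/
structure IsRegularData (α β : Fin 2 → ℝ) (σ ρ : ℝ) (x η : ℕ → ℝ) : Prop where
  recursion : ∀ n, 1 ≤ n → ∀ e : Fin 2, x (2 * n + e) = α e * x n + β e + η (2 * n + e)
  noise_mean : ∀ e : Fin 2, Tendsto (fun r => treeMean r fun i => η (2 * i + e)) atTop (𝓝 0)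
  noise_cov : ∀ e f : Fin 2,
    Tendsto (fun r => treeMean r fun i => η (2 * i + e) * η (2 * i + f)) atTop
      (𝓝 (noiseCov σ ρ e f))
  mother_noise : ∀ e : Fin 2,
    Tendsto (fun r => treeMean r fun i => x i * η (2 * i + e)) atTop (𝓝 0)

variable {α β : Fin 2 → ℝ} {σ ρ : ℝ} {x η : ℕ → ℝ}

namespace IsRegularData

lemma treeMean_daughter (h : IsRegularData α β σ ρ x η) (r : ℕ) (e : Fin 2) :
    treeMean r (fun i => x (2 * i + e))
      = α e * treeMean r x + β e + treeMean r (fun i => η (2 * i + e)) := by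
  rw [treeMean_congr fun i hi => h.recursion i hi e, treeMean_add, treeMean_add,
    treeMean_const_mul, treeMean_const]

lemma treeMean_daughter_sq (h : IsRegularData α β σ ρ x η) (r : ℕ) (e : Fin 2) :
    treeMean r (fun i => x (2 * i + e) ^ 2)
      = α e ^ 2 * treeMean r (fun i => x i ^ 2) + 2 * α e * β e * treeMean r x + β e ^ 2
        + treeMean r (fun i => η (2 * i + e) * η (2 * i + e))
        + 2 * α e * treeMean r (fun i => x i * η (2 * i + e))
        + 2 * β e * treeMean r (fun i => η (2 * i + e)) := by
  rw [treeMean_congr (g := fun i => α e ^ 2 * x i ^ 2 + 2 * α e * β e * x i + β e ^ 2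
        + η (2 * i + e) * η (2 * i + e) + 2 * α e * (x i * η (2 * i + e))
        + 2 * β e * η (2 * i + e)) fun i hi => by rw [h.recursion i hi e]; ring]
  simp only [treeMean_add, treeMean_const_mul, treeMean_const]

lemma treeMean_mother_daughter (h : IsRegularData α β σ ρ x η) (r : ℕ) (e : Fin 2) :
    treeMean r (fun i => x i * x (2 * i + e))
      = α e * treeMean r (fun i => x i ^ 2) + β e * treeMean r x
        + treeMean r (fun i => x i * η (2 * i + e)) := by
  rw [treeMean_congr (g := fun i => α e * x i ^ 2 + β e * x i + x i * η (2 * i + e))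
    fun i hi => by rw [h.recursion i hi e]; ring]
  simp only [treeMean_add, treeMean_const_mul]

lemma exists_tendsto_mean (h : IsRegularData α β σ ρ x η) (hα : ∀ e, α e ∈ Set.Ioo (-1 : ℝ) 1) :
    ∃ M, Tendsto (fun r => treeMean r x) atTop (𝓝 M) ∧
      M = (α 0 * M + β 0 + (α 1 * M + β 1)) / 2 := by
  have hA : |1 / 2 * (α 0 + α 1)| < 1 := by
    have h0 := hα 0
    have h1 := hα 1
    rw [abs_lt]
    constructor <;> linarith [h0.1, h0.2, h1.1, h1.2]
  obtain ⟨M, hM, hM'⟩ := exists_tendsto_of_affine_recursion (m := fun r => treeMean r x) hA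
    (tendsto_growthRatio.mul_const _)
    (b := fun r => x 1 / (subtree (r + 1)).card + growthRatio r *
      (β 0 + β 1 + treeMean r (fun i => η (2 * i + (0 : Fin 2)))
        + treeMean r (fun i => η (2 * i + (1 : Fin 2)))))
    ((((tendsto_add_atTop_iff_nat 1).2 tendsto_card_subtree).const_div_atTop (x 1)).add
      (tendsto_growthRatio.mul (((h.noise_mean 0).const_add _).add (h.noise_mean 1))))
    (fun r => by
      have e0 := h.treeMean_daughter r 0
      have e1 := h.treeMean_daughter r 1
      simp only [Fin.val_zero, Fin.val_one, add_zero] at e0 e1 ⊢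
      rw [treeMean_succ, e0, e1]
      ring)
  exact ⟨M, hM, by linarith⟩

lemma exists_tendsto_mean_sq (h : IsRegularData α β σ ρ x η) (hα : ∀ e, α e ∈ Set.Ioo (-1 : ℝ) 1)
    {M : ℝ} (hM : Tendsto (fun r => treeMean r x) atTop (𝓝 M)) :
    ∃ Q, Tendsto (fun r => treeMean r fun i => x i ^ 2) atTop (𝓝 Q) ∧
      Q = (α 0 ^ 2 * Q + 2 * α 0 * β 0 * M + β 0 ^ 2 + σ ^ 2
        + (α 1 ^ 2 * Q + 2 * α 1 * β 1 * M + β 1 ^ 2 + σ ^ 2)) / 2 := by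
  have hsq : ∀ e, α e ^ 2 < 1 := fun e => by
    rw [sq_lt_one_iff_abs_lt_one, abs_lt]
    exact hα e
  have hA : |1 / 2 * (α 0 ^ 2 + α 1 ^ 2)| < 1 := by
    rw [abs_lt]
    constructor <;> linarith [hsq 0, hsq 1, sq_nonneg (α 0), sq_nonneg (α 1)]
  have hb : ∀ e : Fin 2, Tendsto (fun r => 2 * α e * β e * treeMean r x + β e ^ 2
        + treeMean r (fun i => η (2 * i + e) * η (2 * i + e))
        + 2 * α e * treeMean r (fun i => x i * η (2 * i + e))
        + 2 * β e * treeMean r (fun i => η (2 * i + e))) atTop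
        (𝓝 (2 * α e * β e * M + β e ^ 2 + noiseCov σ ρ e e + 2 * α e * 0 + 2 * β e * 0)) :=
    fun e => ((((hM.const_mul _).add_const _).add (h.noise_cov e e)).add
      ((h.mother_noise e).const_mul _)).add ((h.noise_mean e).const_mul _)
  obtain ⟨Q, hQ, hQ'⟩ := exists_tendsto_of_affine_recursion
    (m := fun r => treeMean r fun i => x i ^ 2) hA (tendsto_growthRatio.mul_const _)
    ((((tendsto_add_atTop_iff_nat 1).2 tendsto_card_subtree).const_div_atTop (x 1 ^ 2)).add
      (tendsto_growthRatio.mul ((hb 0).add (hb 1))))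
    (fun r => by
      have e0 := h.treeMean_daughter_sq r 0
      have e1 := h.treeMean_daughter_sq r 1
      simp only [Fin.val_zero, Fin.val_one, add_zero] at e0 e1 ⊢
      rw [treeMean_succ, e0, e1]
      ring)
  refine ⟨Q, hQ, ?_⟩
  simp only [noiseCov, Matrix.smul_apply, Matrix.of_apply, Matrix.cons_val', Matrix.cons_val_zero,
    Matrix.cons_val_one, Matrix.cons_val_fin_one, smul_eq_mul] at hQ'
  linarith

lemma exists_tendsto_motherVar (h : IsRegularData α β σ ρ x η)
    (hα : ∀ e, α e ∈ Set.Ioo (-1 : ℝ) 1) (hσ : 0 < σ) :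
    ∃ M Q, Tendsto (fun r => treeMean r x) atTop (𝓝 M) ∧
      Tendsto (fun r => treeMean r fun i => x i ^ 2) atTop (𝓝 Q) ∧ 0 < Q - M ^ 2 := by
  obtain ⟨M, hM, hM'⟩ := h.exists_tendsto_mean hα
  obtain ⟨Q, hQ, hQ'⟩ := h.exists_tendsto_mean_sq hα hM
  refine ⟨M, Q, hM, hQ, ?_⟩
  have hsq : ∀ e, α e ^ 2 < 1 := fun e => by
    rw [sq_lt_one_iff_abs_lt_one, abs_lt]
    exact hα e
  -- Total variance over a uniformly chosen daughter type: the noise contributes σ², the spread of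
  -- the two daughter means contributes the last square.
  have key : (Q - M ^ 2) * (1 - (α 0 ^ 2 + α 1 ^ 2) / 2)
      = σ ^ 2 + ((α 0 * M + β 0 - (α 1 * M + β 1)) / 2) ^ 2 := by
    have hMM : M ^ 2 = ((α 0 * M + β 0 + (α 1 * M + β 1)) / 2) ^ 2 := by rw [← hM']
    linear_combination hQ' - hMM
  have hpos : 0 < (Q - M ^ 2) * (1 - (α 0 ^ 2 + α 1 ^ 2) / 2) := by
    rw [key]
    positivity
  exact pos_of_mul_pos_left hpos (by linarith [hsq 0, hsq 1])

lemma tendsto_alphaHat (h : IsRegularData α β σ ρ x η) {M Q : ℝ}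
    (hM : Tendsto (fun r => treeMean r x) atTop (𝓝 M))
    (hQ : Tendsto (fun r => treeMean r fun i => x i ^ 2) atTop (𝓝 Q)) (hV : 0 < Q - M ^ 2)
    (e : Fin 2) : Tendsto (fun r => alphaHat x r e) atTop (𝓝 (α e)) := by
  have hnum : Tendsto (fun r => treeMean r (fun i => x i * x (2 * i + e))
      - treeMean r x * treeMean r (fun i => x (2 * i + e))) atTop
      (𝓝 (α e * Q + β e * M + 0 - M * (α e * M + β e + 0))) := by
    simp_rw [h.treeMean_daughter, h.treeMean_mother_daughter]
    exact (((hQ.const_mul _).add (hM.const_mul _)).add (h.mother_noise e)).sub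
      (hM.mul (((hM.const_mul _).add_const _).add (h.noise_mean e)))
  have := hnum.div (hQ.sub (hM.pow 2)) hV.ne'
  rwa [show (α e * Q + β e * M + 0 - M * (α e * M + β e + 0)) / (Q - M ^ 2) = α e by
    rw [div_eq_iff hV.ne']; ring] at this

lemma tendsto_betaHat (h : IsRegularData α β σ ρ x η) {M Q : ℝ}
    (hM : Tendsto (fun r => treeMean r x) atTop (𝓝 M))
    (hQ : Tendsto (fun r => treeMean r fun i => x i ^ 2) atTop (𝓝 Q)) (hV : 0 < Q - M ^ 2)
    (e : Fin 2) : Tendsto (fun r => betaHat x r e) atTop (𝓝 (β e)) := by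
  simp_rw [betaHat, h.treeMean_daughter]
  have := (((hM.const_mul (α e)).add_const (β e)).add (h.noise_mean e)).sub
    ((h.tendsto_alphaHat hM hQ hV e).mul hM)
  simpa using this

lemma tendsto_treeMean_residue (h : IsRegularData α β σ ρ x η) {M Q : ℝ}
    (hM : Tendsto (fun r => treeMean r x) atTop (𝓝 M))
    (hQ : Tendsto (fun r => treeMean r fun i => x i ^ 2) atTop (𝓝 Q)) (hV : 0 < Q - M ^ 2)
    (e f : Fin 2) :
    Tendsto (fun r => treeMean r fun i => residue x r i e * residue x r i f) atTop
      (𝓝 (noiseCov σ ρ e f)) := by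
  -- Each residue is the noise plus (α - α̂) x + (β - β̂); beyond the noise product, every term
  -- pairs a vanishing factor with a convergent average.
  have hexp : ∀ r, treeMean r (fun i => residue x r i e * residue x r i f)
      = treeMean r (fun i => η (2 * i + e) * η (2 * i + f))
        + (α f - alphaHat x r f) * treeMean r (fun i => x i * η (2 * i + e))
        + (β f - betaHat x r f) * treeMean r (fun i => η (2 * i + e))
        + (α e - alphaHat x r e) * treeMean r (fun i => x i * η (2 * i + f))
        + (β e - betaHat x r e) * treeMean r (fun i => η (2 * i + f))
        + (α e - alphaHat x r e) * (α f - alphaHat x r f) * treeMean r (fun i => x i ^ 2)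
        + ((α e - alphaHat x r e) * (β f - betaHat x r f)
          + (α f - alphaHat x r f) * (β e - betaHat x r e)) * treeMean r x
        + (β e - betaHat x r e) * (β f - betaHat x r f) := by
    intro r
    simp only [← treeMean_const_mul]
    rw [← treeMean_const r ((β e - betaHat x r e) * (β f - betaHat x r f))]
    simp only [← treeMean_add]
    refine treeMean_congr fun i hi => ?_
    rw [residue, residue, h.recursion i hi e, h.recursion i hi f]
    ring
  have ha : ∀ e, Tendsto (fun r => α e - alphaHat x r e) atTop (𝓝 0) := fun e => by
    simpa using (h.tendsto_alphaHat hM hQ hV e).const_sub (α e)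
  have hb : ∀ e, Tendsto (fun r => β e - betaHat x r e) atTop (𝓝 0) := fun e => by
    simpa using (h.tendsto_betaHat hM hQ hV e).const_sub (β e)
  simp_rw [hexp]
  have := (((((((h.noise_cov e f).add ((ha f).mul (h.mother_noise e))).add
    ((hb f).mul (h.noise_mean e))).add ((ha e).mul (h.mother_noise f))).add
    ((hb e).mul (h.noise_mean f))).add (((ha e).mul (ha f)).mul hQ)).add
    ((((ha e).mul (hb f)).add ((ha f).mul (hb e))).mul hM)).add ((hb e).mul (hb f))
  simpa using this

/-- The residual-based estimators are consistent along any regular data set. -/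
theorem consistent (h : IsRegularData α β σ ρ x η)
    (hα : ∀ e, α e ∈ Set.Ioo (-1 : ℝ) 1) (hσ : 0 < σ) :
    (∀ᶠ r in atTop, motherVar x r ≠ 0 ∧ sigmaSqHat x r ≠ 0) ∧
      Tendsto (fun r => (sigmaSqHat x r, rhoHat x r)) atTop (𝓝 (σ ^ 2, ρ)) := by
  obtain ⟨M, Q, hM, hQ, hV⟩ := h.exists_tendsto_motherVar hα hσ
  have hres := h.tendsto_treeMean_residue hM hQ hV
  have hS : Tendsto (fun r => sigmaSqHat x r) atTop (𝓝 (σ ^ 2)) := by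
    have heq : ∀ r, sigmaSqHat x r = (treeMean r (fun i => residue x r i 0 * residue x r i 0)
        + treeMean r (fun i => residue x r i 1 * residue x r i 1)) / 2 := by
      intro r
      have := (card_subtree_pos r).ne'
      rw [sigmaSqHat, treeMean, treeMean, Finset.sum_add_distrib]
      simp only [pow_two]
      field_simp
    simp_rw [heq]
    simpa [noiseCov] using ((hres 0 0).add (hres 1 1)).div_const 2
  have hσ2 : σ ^ 2 ≠ 0 := by positivity
  have hR : Tendsto (fun r => rhoHat x r) atTop (𝓝 ρ) := by
    have heq : ∀ r, rhoHat x r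
        = treeMean r (fun i => residue x r i 0 * residue x r i 1) / sigmaSqHat x r := by
      intro r
      rw [rhoHat, treeMean, div_div, mul_comm (sigmaSqHat x r)]
    simp_rw [heq]
    have hlim : noiseCov σ ρ 0 1 / σ ^ 2 = ρ := by simp [noiseCov, mul_div_cancel_left₀ _ hσ2]
    exact hlim ▸ (hres 0 1).div hS hσ2
  exact ⟨((hQ.sub (hM.pow 2)).eventually_ne hV.ne').and (hS.eventually_ne hσ2),
    hS.prodMk_nhds hR⟩

end IsRegularData

end BAR

/-! ### Two general facts -/

/-- A nonnegative sequence whose integrals are summable converges to zero almost surely. -/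
lemma MeasureTheory.ae_tendsto_zero_of_summable_integral {Ω : Type*} [MeasurableSpace Ω]
    {μ : Measure Ω} {f : ℕ → Ω → ℝ} (hf : ∀ n, Integrable (f n) μ) (h0 : ∀ n ω, 0 ≤ f n ω)
    (hs : Summable fun n => ∫ ω, f n ω ∂μ) :
    ∀ᵐ ω ∂μ, Tendsto (fun n => f n ω) atTop (𝓝 0) := by
  have hm : ∀ n, AEMeasurable (fun ω => ENNReal.ofReal (f n ω)) μ :=
    fun n => (hf n).aemeasurable.ennreal_ofReal
  have hfin : ∫⁻ ω, ∑' n, ENNReal.ofReal (f n ω) ∂μ ≠ ⊤ := by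
    rw [lintegral_tsum hm]
    simp_rw [← fun n => ofReal_integral_eq_lintegral_ofReal (hf n) (Eventually.of_forall (h0 n))]
    exact hs.tsum_ofReal_ne_top
  filter_upwards [ae_lt_top' (AEMeasurable.tsum hm) hfin] with ω hω
  have h := ENNReal.tendsto_atTop_zero_of_tsum_ne_top hω.ne
  have h' := (ENNReal.tendsto_toReal ENNReal.zero_ne_top).comp h
  simpa [Function.comp_def, ENNReal.toReal_ofReal (h0 _ ω)] using h'

/-- The joint law of the triple is the product of its three marginals, and product measures are
associative. -/
lemma ProbabilityTheory.IndepFun.prodMk_left_of_prodMk_right {Ω A B C : Type*}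
    [MeasurableSpace Ω] [MeasurableSpace A] [MeasurableSpace B] [MeasurableSpace C]
    {μ : Measure Ω} [IsProbabilityMeasure μ] {f : Ω → A} {g : Ω → B} {h : Ω → C}
    (hf : Measurable f) (hg : Measurable g) (hh : Measurable h)
    (hfgh : IndepFun f (fun ω => (g ω, h ω)) μ) (hgh : IndepFun g h μ) :
    IndepFun (fun ω => (f ω, g ω)) h μ := by
  have hfg : IndepFun f g μ := hfgh.comp measurable_id measurable_fst
  have := Measure.isProbabilityMeasure_map (μ := μ) hf.aemeasurable
  have := Measure.isProbabilityMeasure_map (μ := μ) hg.aemeasurable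
  have := Measure.isProbabilityMeasure_map (μ := μ) hh.aemeasurable
  rw [indepFun_iff_map_prod_eq_prod_map_map (by fun_prop) (by fun_prop)] at hfgh hgh hfg ⊢
  rw [hgh, ← Measure.prodAssoc_prod] at hfgh
  rw [hfg]
  apply MeasurableEquiv.prodAssoc.map_measurableEquiv_injective
  rw [← hfgh, Measure.map_map MeasurableEquiv.prodAssoc.measurable (by fun_prop)]
  rfl

namespace BAR

/-! ### Moments of the noise -/

lemma posSemidef_noiseCov (σ : ℝ) {ρ : ℝ} (hρ : ρ ∈ Set.Ioo (-1 : ℝ) 1) :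
    (noiseCov σ ρ).PosSemidef := by
  refine Matrix.PosSemidef.of_dotProduct_mulVec_nonneg ?_ fun v => ?_
  · ext i j
    fin_cases i <;> fin_cases j <;> simp [noiseCov]
  -- The square is completed in `v 0`.
  · have h : star v ⬝ᵥ (noiseCov σ ρ).mulVec v
        = σ ^ 2 * ((v 0 + ρ * v 1) ^ 2 + (1 - ρ ^ 2) * v 1 ^ 2) := by
      simp [noiseCov, Matrix.mulVec, dotProduct, Fin.sum_univ_two]
      ring
    have h1 : 0 ≤ 1 - ρ ^ 2 := by nlinarith [hρ.1, hρ.2]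
    rw [h]
    positivity

lemma memLp_eval_multivariateGaussian (S : Matrix (Fin 2) (Fin 2) ℝ) (e : Fin 2) :
    MemLp (fun x : EuclideanSpace ℝ (Fin 2) => x e) 2 (multivariateGaussian 0 S) :=
  (EuclideanSpace.proj (𝕜 := ℝ) e).comp_memLp' IsGaussian.memLp_two_id

lemma integral_eval_multivariateGaussian (S : Matrix (Fin 2) (Fin 2) ℝ) (e : Fin 2) :
    ∫ x : EuclideanSpace ℝ (Fin 2), x e ∂multivariateGaussian 0 S = 0 := by
  have h := (EuclideanSpace.proj (𝕜 := ℝ) e).integral_comp_comm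
    (IsGaussian.integrable_id (μ := multivariateGaussian 0 S))
  simpa using h

lemma integral_eval_mul_eval_multivariateGaussian {S : Matrix (Fin 2) (Fin 2) ℝ}
    (hS : S.PosSemidef) (e f : Fin 2) :
    ∫ x : EuclideanSpace ℝ (Fin 2), x e * x f ∂multivariateGaussian 0 S = S e f := by
  have h := covariance_eval_multivariateGaussian (μ := 0) hS e f
  rw [covariance_eq_sub (memLp_eval_multivariateGaussian S e)
    (memLp_eval_multivariateGaussian S f)] at h
  simpa [integral_eval_multivariateGaussian] using h

/-- The initial value together with the noise pairs of index less than `j`. -/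
def past {Ω : Type*} (X ε : ℕ → Ω → ℝ) (j : ℕ+) (ω : Ω) :
    ℝ × (Finset.Iio j → EuclideanSpace ℝ (Fin 2)) :=
  (X 1 ω, fun n => noisePair ε n ω)

lemma measurable_comap_past_noisePair {Ω : Type*} {X ε : ℕ → Ω → ℝ} {j n : ℕ+}
    (hn : n < j) :
    Measurable[MeasurableSpace.comap (past X ε j) inferInstance] (noisePair ε n) := by
  have hg : Measurable fun p : ℝ × (Finset.Iio j → EuclideanSpace ℝ (Fin 2)) =>
      p.2 ⟨n, Finset.mem_Iio.2 hn⟩ := by fun_prop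
  exact hg.comp (comap_measurable (past X ε j))

lemma measurable_comap_past_noise {Ω : Type*} {X ε : ℕ → Ω → ℝ} {j : ℕ} (hj : 1 ≤ j)
    {i : ℕ} (hi : 1 ≤ i) (hij : i < j) (e : Fin 2) :
    Measurable[MeasurableSpace.comap (past X ε ⟨j, hj⟩) inferInstance] (ε (2 * i + e)) := by
  have hg : Measurable fun x : EuclideanSpace ℝ (Fin 2) => x e := by fun_prop
  exact hg.comp (measurable_comap_past_noisePair (n := ⟨i, hi⟩) hij)

namespace IsBAR

variable {Ω : Type*} [MeasurableSpace Ω] {P : Measure Ω} {ν : Measure ℝ}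
  {α β : Fin 2 → ℝ} {σ ρ : ℝ} {X ε : ℕ → Ω → ℝ}

lemma measurable_noisePair (h : IsBAR P ν α β σ ρ X ε) (n : ℕ+) : Measurable (noisePair ε n) := by
  refine (WithLp.measurable_toLp 2 _).comp (measurable_pi_lambda _ fun e => ?_)
  exact h.measurable_noise _ (by have := n.pos; omega)

/-! ### The law of large numbers for the noise -/

/-- Subtrees are initial segments of the positive integers, so tree averages are a subsequence of
the Cesàro averages in the strong law. -/
lemma ae_tendsto_treeMean_noise (h : IsBAR P ν α β σ ρ X ε)
    {g : EuclideanSpace ℝ (Fin 2) → ℝ} (hg : Measurable g)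
    (hint : Integrable g (multivariateGaussian 0 (noiseCov σ ρ))) :
    ∀ᵐ ω ∂P, Tendsto
      (fun r => treeMean r fun i => g (WithLp.toLp 2 fun e : Fin 2 => ε (2 * i + e) ω)) atTop
      (𝓝 (∫ x, g x ∂multivariateGaussian 0 (noiseCov σ ρ))) := by
  have hlaw : ∀ n : ℕ+, P.map (noisePair ε n) = multivariateGaussian 0 (noiseCov σ ρ) :=
    fun n => (h.noise_law n).map_eq
  have hm := h.measurable_noisePair
  have hident : ∀ m n : ℕ+,
      IdentDistrib (fun ω => g (noisePair ε m ω)) (fun ω => g (noisePair ε n ω)) P P := fun m n =>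
    IdentDistrib.comp ⟨(hm m).aemeasurable, (hm n).aemeasurable, by rw [hlaw, hlaw]⟩ hg
  have hslln := strong_law_ae_real (μ := P) (fun i ω => g (noisePair ε i.succPNat ω))
    (by
      rw [← hlaw (Nat.succPNat 0)] at hint
      exact hint.comp_measurable (hm _))
    (fun i j hij => (h.noise_indep.indepFun (Nat.succPNat_injective.ne hij)).comp hg hg)
    (fun i => hident _ _)
  have hmean : ∫ ω, g (noisePair ε (Nat.succPNat 0) ω) ∂P
      = ∫ x, g x ∂multivariateGaussian 0 (noiseCov σ ρ) := by
    rw [← hlaw (Nat.succPNat 0), integral_map (hm _).aemeasurable hg.aestronglyMeasurable]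
  rw [hmean] at hslln
  have hN : Tendsto (fun r => (subtree r).card) atTop atTop :=
    tendsto_natCast_atTop_iff.1 tendsto_card_subtree
  filter_upwards [hslln] with ω hω
  refine (hω.comp hN).congr fun r => ?_
  simp only [Function.comp_def, treeMean]
  congr 1
  rw [subtree_eq_Ico, Finset.sum_Ico_eq_sum_range, Nat.card_Ico]
  refine Finset.sum_congr rfl fun i _ => ?_
  simp [noisePair, add_comm 1 i]

/-! ### Second moments of the process -/

lemma integrable_noise_mul (h : IsBAR P ν α β σ ρ X ε) {n : ℕ} (hn : 1 ≤ n) (e f : Fin 2) :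
    Integrable (fun ω => ε (2 * n + e) ω * ε (2 * n + f) ω) P := by
  have hlaw := (h.noise_law ⟨n, hn⟩).map_eq
  have hint := (memLp_eval_multivariateGaussian (noiseCov σ ρ) e).integrable_mul
    (memLp_eval_multivariateGaussian (noiseCov σ ρ) f)
  rw [← hlaw] at hint
  exact hint.comp_measurable (h.measurable_noisePair _)

lemma integral_noise_sq (h : IsBAR P ν α β σ ρ X ε) (hρ : ρ ∈ Set.Ioo (-1 : ℝ) 1) {n : ℕ}
    (hn : 1 ≤ n) (e : Fin 2) : ∫ ω, ε (2 * n + e) ω ^ 2 ∂P = σ ^ 2 := by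
  have hS := integral_eval_mul_eval_multivariateGaussian (posSemidef_noiseCov σ hρ) e e
  have hσ : noiseCov σ ρ e e = σ ^ 2 := by fin_cases e <;> simp [noiseCov]
  simp_rw [pow_two (ε _ _)]
  exact ((h.noise_law ⟨n, hn⟩).integral_comp (f := fun x => x e * x e)
    (by fun_prop)).trans (hS.trans hσ)

lemma integral_noise (h : IsBAR P ν α β σ ρ X ε) {n : ℕ}
    (hn : 1 ≤ n) (e : Fin 2) : ∫ ω, ε (2 * n + e) ω ∂P = 0 := by
  have hS := integral_eval_multivariateGaussian (noiseCov σ ρ) e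
  exact ((h.noise_law ⟨n, hn⟩).integral_comp (f := fun x => x e) (by fun_prop)).trans hS

lemma memLp_noise (h : IsBAR P ν α β σ ρ X ε) {n : ℕ} (hn : 1 ≤ n) (e : Fin 2) :
    MemLp (ε (2 * n + e)) 2 P := by
  rw [memLp_two_iff_integrable_sq (h.measurable_noise _ (by omega)).aestronglyMeasurable]
  simpa [pow_two] using h.integrable_noise_mul hn e e

/-- Each `n ≥ 2` is the daughter of type `n % 2` of `n / 2`. -/
lemma induction_nodes {p : ℕ → Prop} (h1 : p 1)
    (hs : ∀ n, 1 ≤ n → p n → ∀ e : Fin 2, p (2 * n + e)) : ∀ n, 1 ≤ n → p n := by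
  intro n
  induction n using Nat.strong_induction_on with
  | _ n ih =>
    intro hn
    rcases hn.eq_or_lt with rfl | hn
    · exact h1
    · have key := hs (n / 2) (by omega) (ih _ (by omega) (by omega)) ⟨n % 2, by omega⟩
      rwa [Nat.div_add_mod] at key

lemma memLp_process [IsProbabilityMeasure P] (h : IsBAR P ν α β σ ρ X ε)
    (hν : Integrable (fun x : ℝ => x ^ 2) ν) : ∀ n, 1 ≤ n → MemLp (X n) 2 P := by
  refine induction_nodes ?_ fun n hn ih e => ?_
  · rw [memLp_two_iff_integrable_sq (h.measurable_process 1 le_rfl).aestronglyMeasurable]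
    rw [← h.ancestor_law.map_eq] at hν
    exact hν.comp_measurable (h.measurable_process 1 le_rfl)
  · rw [funext (h.recursion n hn e)]
    exact ((ih.const_mul (α e)).add (memLp_const (β e))).add (h.memLp_noise hn e)

/-- Convexity of the square, with weights |a| and 1 - |a| on ±z and (b + y)/(1 - |a|). No cross term
remains, so second moments can be bounded without using independence. -/
lemma sq_affine_le {a b y : ℝ} (ha : |a| < 1) (z : ℝ) :
    (a * z + b + y) ^ 2 ≤ |a| * z ^ 2 + (2 * b ^ 2 + 2 * y ^ 2) / (1 - |a|) := by
  have h1 : 0 < 1 - |a| := by linarith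
  have h2 : (a * z + b + y) ^ 2 ≤ |a| * z ^ 2 + (b + y) ^ 2 / (1 - |a|) := by
    rw [← sub_le_iff_le_add', le_div_iff₀ h1]
    rcases abs_cases a with ⟨ha', _⟩ | ⟨ha', _⟩ <;> rw [ha'] at h1 ⊢
    · nlinarith [mul_nonneg (abs_nonneg a) (sq_nonneg ((1 - a) * z - (b + y)))]
    · nlinarith [mul_nonneg (abs_nonneg a) (sq_nonneg ((1 + a) * z + (b + y)))]
  refine h2.trans (add_le_add_right (div_le_div_of_nonneg_right ?_ h1.le) _)
  nlinarith [sq_nonneg (b - y)]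

lemma exists_integral_sq_le [IsProbabilityMeasure P] (h : IsBAR P ν α β σ ρ X ε)
    (hρ : ρ ∈ Set.Ioo (-1 : ℝ) 1) (hα : ∀ e, α e ∈ Set.Ioo (-1 : ℝ) 1)
    (hν : Integrable (fun x : ℝ => x ^ 2) ν) :
    ∃ K, ∀ n, 1 ≤ n → ∫ ω, X n ω ^ 2 ∂P ≤ K := by
  have hα' : ∀ e, |α e| < 1 := fun e => abs_lt.2 (hα e)
  set B : Fin 2 → ℝ := fun e => (2 * β e ^ 2 + 2 * σ ^ 2) / (1 - |α e|) with hB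
  -- `C e` solves |α e| C + B e = C, so any bound K ≥ C e passes from mother to daughter.
  set C : Fin 2 → ℝ := fun e => B e / (1 - |α e|) with hC
  refine ⟨max (∫ ω, X 1 ω ^ 2 ∂P) (max (C 0) (C 1)), induction_nodes (le_max_left _ _)
    fun n hn ih e => ?_⟩
  set K := max (∫ ω, X 1 ω ^ 2 ∂P) (max (C 0) (C 1))
  have hCK : C e ≤ K := by
    fin_cases e
    · exact (le_max_left _ _).trans (le_max_right _ _)
    · exact (le_max_right _ _).trans (le_max_right _ _)
  have h1 : 0 < 1 - |α e| := by linarith [hα' e]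
  have hBK : B e ≤ K * (1 - |α e|) := (div_le_iff₀ h1).1 hCK
  have iX := (h.memLp_process hν n hn).integrable_sq
  have iε := (h.memLp_noise hn e).integrable_sq
  have iB : Integrable
      (fun ω => (2 * β e ^ 2 + 2 * ε (2 * n + e) ω ^ 2) / (1 - |α e|)) P :=
    ((integrable_const _).add (iε.const_mul 2)).div_const _
  calc ∫ ω, X (2 * n + e) ω ^ 2 ∂P
      ≤ ∫ ω, (|α e| * X n ω ^ 2
          + (2 * β e ^ 2 + 2 * ε (2 * n + e) ω ^ 2) / (1 - |α e|)) ∂P := by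
        refine integral_mono (h.memLp_process hν _ (by omega)).integrable_sq
          ((iX.const_mul _).add iB) fun ω => ?_
        simp only [h.recursion n hn e ω]
        exact sq_affine_le (hα' e) _
    _ = |α e| * ∫ ω, X n ω ^ 2 ∂P + B e := by
        rw [integral_add (iX.const_mul _) iB, integral_const_mul, integral_div,
          integral_add (integrable_const _) (iε.const_mul 2), integral_const_mul 2 fun ω =>
            ε (2 * n + e) ω ^ 2, h.integral_noise_sq hρ hn e]
        simp [hB]
    _ ≤ |α e| * K + K * (1 - |α e|) :=
        add_le_add (mul_le_mul_of_nonneg_left ih (abs_nonneg _)) hBK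
    _ = K := by ring

/-! ### Independence of the noise from the past -/

lemma indepFun_past [IsProbabilityMeasure P] (h : IsBAR P ν α β σ ρ X ε) (j : ℕ+) :
    IndepFun (past X ε j) (noisePair ε j) P := by
  have hpair : Measurable fun v : ℕ+ → EuclideanSpace ℝ (Fin 2) =>
      ((fun n : Finset.Iio j => v n), v j) := by fun_prop
  refine IndepFun.prodMk_left_of_prodMk_right (h.measurable_process 1 le_rfl)
    (measurable_pi_lambda _ fun n => h.measurable_noisePair n) (h.measurable_noisePair j)
    (h.ancestor_indep.comp measurable_id hpair) ?_
  have hfin := h.noise_indep.indepFun_finset (Finset.Iio j) {j} (by simp) h.measurable_noisePair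
  exact hfin.comp measurable_id
    (measurable_pi_apply (⟨j, Finset.mem_singleton_self j⟩ : ({j} : Finset ℕ+)))

lemma indepFun_noise [IsProbabilityMeasure P] (h : IsBAR P ν α β σ ρ X ε) {j : ℕ} (hj : 1 ≤ j)
    {Y : Ω → ℝ} (hY : Measurable[MeasurableSpace.comap (past X ε ⟨j, hj⟩) inferInstance] Y)
    (e : Fin 2) : IndepFun Y (ε (2 * j + e)) P := by
  have h1 : IndepFun Y (noisePair ε ⟨j, hj⟩) P :=
    indep_of_indep_of_le_left (h.indepFun_past ⟨j, hj⟩) hY.comap_le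
  exact h1.comp measurable_id (by fun_prop : Measurable fun x : EuclideanSpace ℝ (Fin 2) => x e)

/-- If 2n + e ≤ j then n < j, so unfolding the recursion uses only noise pairs before `j`. The case
`i = j` makes a mother independent of her own daughters' noise. -/
lemma measurable_comap_past_process (h : IsBAR P ν α β σ ρ X ε) {j : ℕ} (hj : 1 ≤ j) :
    ∀ i, 1 ≤ i → i ≤ j →
      Measurable[MeasurableSpace.comap (past X ε ⟨j, hj⟩) inferInstance] (X i) := by
  refine induction_nodes (fun _ => measurable_fst.comp (comap_measurable _))
    fun n hn ih e hle => ?_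
  rw [funext (h.recursion n hn e)]
  exact (((ih (by omega)).const_mul _).add_const _).add
    (measurable_comap_past_noise hj hn (by omega) e)

/-! ### The martingale part -/

/-- The products of the mothers with the noise of their daughters are square integrable and
orthogonal, so that the second moments of their sums grow at most linearly. -/
lemma integral_sum_mother_noise_sq_le [IsProbabilityMeasure P] (h : IsBAR P ν α β σ ρ X ε)
    (hρ : ρ ∈ Set.Ioo (-1 : ℝ) 1) (hν : Integrable (fun x : ℝ => x ^ 2) ν) {K : ℝ}
    (hK : ∀ n, 1 ≤ n → ∫ ω, X n ω ^ 2 ∂P ≤ K) (e : Fin 2) (n : ℕ) (hn : 1 ≤ n) :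
    MemLp (fun ω => ∑ i ∈ Finset.Ico 1 n, X i ω * ε (2 * i + e) ω) 2 P ∧
      ∫ ω, (∑ i ∈ Finset.Ico 1 n, X i ω * ε (2 * i + e) ω) ^ 2 ∂P ≤ n * (K * σ ^ 2) := by
  have hK0 : 0 ≤ K := (integral_nonneg fun ω => sq_nonneg _).trans (hK 1 le_rfl)
  induction n, hn using Nat.le_induction with
  | base => simpa using mul_nonneg hK0 (sq_nonneg σ)
  | succ n hn ih =>
    obtain ⟨hL, hle⟩ := ih
    set S : Ω → ℝ := fun ω => ∑ i ∈ Finset.Ico 1 n, X i ω * ε (2 * i + e) ω with hS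
    have mX := h.measurable_process n hn
    have mε : Measurable (ε (2 * n + e)) := h.measurable_noise _ (by omega)
    have pX := h.measurable_comap_past_process hn n hn le_rfl
    have pS : Measurable[MeasurableSpace.comap (past X ε ⟨n, hn⟩) inferInstance] S := by
      refine Finset.measurable_sum _ fun i hi => ?_
      obtain ⟨hi1, hin⟩ := Finset.mem_Ico.1 hi
      exact (h.measurable_comap_past_process hn i hi1 hin.le).mul
        (measurable_comap_past_noise hn hi1 hin e)
    have hXL := h.memLp_process hν n hn
    have hεL := h.memLp_noise hn e
    -- Both factors are only known to lie in L²; independence of their squares is what puts the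
    -- product in L².
    have indX : IndepFun (fun ω => X n ω ^ 2) (fun ω => ε (2 * n + e) ω ^ 2) P :=
      (h.indepFun_noise hn pX e).comp (measurable_id.pow_const 2) (measurable_id.pow_const 2)
    have indS : IndepFun (fun ω => S ω * X n ω) (ε (2 * n + e)) P :=
      h.indepFun_noise hn (pS.mul pX) e
    have hD : MemLp (fun ω => X n ω * ε (2 * n + e) ω) 2 P := by
      refine (memLp_two_iff_integrable_sq (mX.mul mε).aestronglyMeasurable).2 ?_
      simp_rw [Pi.mul_apply, mul_pow]
      exact indX.integrable_mul hXL.integrable_sq hεL.integrable_sq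
    have hD2 : ∫ ω, (X n ω * ε (2 * n + e) ω) ^ 2 ∂P ≤ K * σ ^ 2 := by
      simp_rw [mul_pow]
      rw [indX.integral_fun_mul_eq_mul_integral (mX.pow_const 2).aestronglyMeasurable
        (mε.pow_const 2).aestronglyMeasurable, h.integral_noise_sq hρ hn e]
      exact mul_le_mul_of_nonneg_right (hK n hn) (sq_nonneg σ)
    have hcross : ∫ ω, S ω * (X n ω * ε (2 * n + e) ω) ∂P = 0 := by
      simp_rw [← mul_assoc]
      rw [indS.integral_fun_mul_eq_mul_integral
        (hL.aestronglyMeasurable.mul mX.aestronglyMeasurable) mε.aestronglyMeasurable,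
        h.integral_noise hn e, mul_zero]
    simp_rw [Finset.sum_Ico_succ_top hn]
    refine ⟨hL.add hD, ?_⟩
    have hexp : ∀ ω, (S ω + X n ω * ε (2 * n + e) ω) ^ 2
        = S ω ^ 2 + 2 * (S ω * (X n ω * ε (2 * n + e) ω)) + (X n ω * ε (2 * n + e) ω) ^ 2 :=
      fun ω => by ring
    change ∫ ω, (S ω + X n ω * ε (2 * n + e) ω) ^ 2 ∂P ≤ _
    simp_rw [hexp]
    have iC : Integrable (fun ω => 2 * (S ω * (X n ω * ε (2 * n + e) ω))) P :=
      (hL.integrable_mul hD).const_mul 2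
    have iSC : Integrable (fun ω => S ω ^ 2 + 2 * (S ω * (X n ω * ε (2 * n + e) ω))) P :=
      hL.integrable_sq.add iC
    rw [integral_add iSC hD.integrable_sq, integral_add hL.integrable_sq iC, integral_const_mul, hcross]
    push_cast
    linarith

lemma ae_tendsto_treeMean_mother_noise [IsProbabilityMeasure P] (h : IsBAR P ν α β σ ρ X ε)
    (hρ : ρ ∈ Set.Ioo (-1 : ℝ) 1) (hα : ∀ e, α e ∈ Set.Ioo (-1 : ℝ) 1)
    (hν : Integrable (fun x : ℝ => x ^ 2) ν) (e : Fin 2) :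
    ∀ᵐ ω ∂P, Tendsto (fun r => treeMean r fun i => X i ω * ε (2 * i + e) ω) atTop (𝓝 0) := by
  obtain ⟨K, hK⟩ := h.exists_integral_sq_le hρ hα hν
  have hK0 : 0 ≤ K := (integral_nonneg fun ω => sq_nonneg _).trans (hK 1 le_rfl)
  have hC := fun r : ℕ => h.integral_sum_mother_noise_sq_le hρ hν hK e (2 ^ (r + 1))
    Nat.one_le_two_pow
  have hsq : ∀ r ω, (treeMean r fun i => X i ω * ε (2 * i + e) ω) ^ 2
      = (∑ i ∈ Finset.Ico 1 (2 ^ (r + 1)), X i ω * ε (2 * i + e) ω) ^ 2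
        / (subtree r).card ^ 2 := fun r ω => by
    rw [treeMean, div_pow]
    congr 3
    exact subtree_eq_Ico r
  have hsum : Summable fun r =>
      ∫ ω, (treeMean r fun i => X i ω * ε (2 * i + e) ω) ^ 2 ∂P := by
    -- The sum has second moment at most 2^(r+1) K σ², and the squared cardinality is at least 4^r;
    -- their quotient is 2 K σ² 2⁻ʳ.
    refine Summable.of_nonneg_of_le (fun r => integral_nonneg fun ω => sq_nonneg _) (fun r => ?_)
      ((summable_geometric_two).mul_left (2 * (K * σ ^ 2)))
    simp_rw [hsq]
    rw [integral_div, div_le_iff₀ (pow_pos (card_subtree_pos r) 2)]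
    refine (hC r).2.trans ?_
    have h2 : (1 : ℝ) ≤ 2 ^ r := one_le_pow₀ (by norm_num)
    have hcard : (2 : ℝ) ^ r ≤ (subtree r).card := by
      rw [card_subtree_cast, pow_succ]
      linarith
    have hpow : (2 : ℝ) ^ r ≤ (1 / 2) ^ r * ((subtree r).card : ℝ) ^ 2 := by
      have h3 : ((2 : ℝ) ^ r) ^ 2 ≤ ((subtree r).card : ℝ) ^ 2 :=
        pow_le_pow_left₀ (by positivity) hcard 2
      rw [one_div, inv_pow, ← div_eq_inv_mul, le_div_iff₀ (by positivity)]
      nlinarith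
    have := mul_le_mul_of_nonneg_left hpow (mul_nonneg hK0 (sq_nonneg σ))
    push_cast
    rw [pow_succ]
    nlinarith
  have hae := ae_tendsto_zero_of_summable_integral
    (fun r => by
      simp_rw [hsq]
      exact (hC r).1.integrable_sq.div_const _) (fun r ω => sq_nonneg _) hsum
  filter_upwards [hae] with ω hω
  have := hω.sqrt
  simp only [Real.sqrt_sq_eq_abs, Real.sqrt_zero] at this
  exact (tendsto_zero_iff_abs_tendsto_zero _).2 this

theorem ae_isRegularData [IsProbabilityMeasure P] (h : IsBAR P ν α β σ ρ X ε)
    (hρ : ρ ∈ Set.Ioo (-1 : ℝ) 1) (hα : ∀ e, α e ∈ Set.Ioo (-1 : ℝ) 1)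
    (hν : Integrable (fun x : ℝ => x ^ 2) ν) :
    ∀ᵐ ω ∂P, IsRegularData α β σ ρ (fun n => X n ω) (fun n => ε n ω) := by
  have hmean : ∀ e : Fin 2, ∀ᵐ ω ∂P,
      Tendsto (fun r => treeMean r fun i => ε (2 * i + e) ω) atTop (𝓝 0) := fun e => by
    have := h.ae_tendsto_treeMean_noise (g := fun x => x e) (by fun_prop)
      ((memLp_eval_multivariateGaussian _ e).integrable (by norm_num))
    rwa [integral_eval_multivariateGaussian] at this
  have hcov : ∀ e f : Fin 2, ∀ᵐ ω ∂P,
      Tendsto (fun r => treeMean r fun i => ε (2 * i + e) ω * ε (2 * i + f) ω) atTop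
        (𝓝 (noiseCov σ ρ e f)) := fun e f => by
    have := h.ae_tendsto_treeMean_noise (g := fun x => x e * x f) (by fun_prop)
      ((memLp_eval_multivariateGaussian _ e).integrable_mul (memLp_eval_multivariateGaussian _ f))
    rwa [integral_eval_mul_eval_multivariateGaussian (posSemidef_noiseCov σ hρ)] at this
  filter_upwards [ae_all_iff.2 hmean, ae_all_iff.2 fun e => ae_all_iff.2 (hcov e),
    ae_all_iff.2 (h.ae_tendsto_treeMean_mother_noise hρ hα hν)] with ω h1 h2 h3
  exact ⟨fun n hn e => h.recursion n hn e ω, h1, h2, h3⟩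

end IsBAR

end BAR

theorem proposition34 {Ω : Type*} [MeasurableSpace Ω] (P : Measure Ω) [IsProbabilityMeasure P]
    (ν : Measure ℝ) (α β : Fin 2 → ℝ) (σ ρ : ℝ) (X ε : ℕ → Ω → ℝ)
    (hα : ∀ e, α e ∈ Set.Ioo (-1 : ℝ) 1) (hσ : 0 < σ) (hρ : ρ ∈ Set.Ioo (-1 : ℝ) 1)
    (hX : BAR.IsBAR P ν α β σ ρ X ε)
    (hν : ∀ k : ℕ, Integrable (fun x : ℝ => |x| ^ k) ν) :
    ∀ᵐ ω ∂P,
      (∀ᶠ r in atTop, BAR.motherVar (fun n => X n ω) r ≠ 0 ∧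
        BAR.sigmaSqHat (fun n => X n ω) r ≠ 0) ∧
      Tendsto (fun r => (BAR.sigmaSqHat (fun n => X n ω) r, BAR.rhoHat (fun n => X n ω) r))
        atTop (𝓝 (σ ^ 2, ρ)) := by
  have hν2 : Integrable (fun x : ℝ => x ^ 2) ν := by simpa using hν 2
  filter_upwards [hX.ae_isRegularData hρ hα hν2] with ω hω
  exact hω.consistent hα hσ
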